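/- **Theorem (Burge summation formula).** For integers $N,M\ge 0$, a *partition in $(N,M)$* is a sequence of integers $M\ge p_N\ge p_{N-1}\ge\cdots\ge p_1\ge 0$; its weight is $\mathrm{wt}(p)=p_1+\cdots+p_N$. If $N<0$ or $M<0$ there are no partitions in $(N,M)$. Use the conventions $p_i=0$ for $i\le 0$ and $p_i=M$ for $i>N$. For integers $N_1,M_1,N_2,M_2,a,b,\alpha,\beta$, let $\mathcal R(N_1,M_1,N_2,M_2,a,b,\alpha,\beta)$ be the set of pairs $(r,p)$, with $r$ a partition in $(N_1,M_1)$ and $p$ a partition in $(N_2,M_2)$, such that $$p_i-r_{i+1-a}\ge 1-\alpha\quad\text{for }\max\{1,a\}\le i\le\min\{N_2,N_1+a-1\},$$ $$r_i-p_{i+1-b}\ge 1-\beta\quad\text{for }\max\{1,b\}\le i\le\min\{N_1,N_2+b-1\},$$ and, moreover: if $a=0$ then $r_1\le\alpha-1$; if $b=0$ then $p_1\le\beta-1$; if $a=N_2-N_1$ then $p_{N_2}\ge M_1-\alpha+1$; if $b=N_1-N_2$ then $r_{N_1}\ge M_2-\beta+1$. Let $$R(N_1,M_1,N_2,M_2,a,b,\alpha,\beta)=\sum_{(r,p)\in\mathcal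 R(N_1,M_1,N_2,M_2,a,b,\alpha,\beta)}q^{\mathrm{wt}(r)+\mathrm{wt}(p)}$$ (so $R=0$ if one of $N_1,M_1,N_2,M_2$ is negative). Let $(q)_n=\prod_{j=1}^n(1-q^j)$, and let $\left[{P\atop N}\right]=\dfrac{(q)_P}{(q)_N(q)_{P-N}}$ if $P\ge N\ge 0$, and $\left[{P\atop N}\right]=0$ otherwise. Let $N_1,M_1,N_2,M_2,a,b$ be non-negative integers and $\alpha,\beta$ integers with $a+b>0$, $\alpha-a\ge 0$, $\beta-b\ge 0$ and $(\alpha-a)+(\beta-b)>0$. Put $\Delta N=N_1-N_2$ and $\Delta M=M_1-M_2$, and suppose that $-a\le\Delta N\le b$, $-\beta\le\Delta M\le\alpha$, $b-\beta\le\Delta M+\Delta N\le\alpha-a$, and $M_1+\Delta N\ge 0$, $M_2-\Delta N\ge 0$. Then, as an identity in the indeterminate $q$, $$R(N_1,M_1,N_2,M_2,a,b,\alpha,\beta)=\sum_{i=0}^{N_2}q^{i^2+i\Delta N}\left[{M_1+M_2+N_2-i\atop N_2-i}\right]R(i+\Delta N,\,M_1-i,\,i,\,M_2-\Delta N-i,\,a,\,b,\,\alpha-a,\,\beta-b).$$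 -/

import Mathlib

/-- The partitions in `(N, M)`, that is, the sequences `0 ≤ p_1 ≤ p_2 ≤ ⋯ ≤ p_N ≤ M` of `N` integers;
`p j` is the part `p_{j+1}`. There are none if `N < 0` or `M < 0`, and exactly one
(the empty sequence) if `N = 0 ≤ M`. -/
noncomputable def boxPartitions (N M : ℤ) : Finset (Fin N.toNat → ℤ) :=
  if 0 ≤ N ∧ 0 ≤ M then
    (Fintype.piFinset fun _ => Finset.Icc 0 M).filter fun p => ∀ j k, j ≤ k → p j ≤ p k
  else ∅

/-- The part `p_i` of a partition in `(N, M)`, where `1 ≤ i ≤ N`, extended by the usual convention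
`p_i = 0` for `i ≤ 0` and `p_i = M` for `i > N`. -/
noncomputable def boxPart (N M : ℤ) (p : Fin N.toNat → ℤ) (i : ℤ) : ℤ :=
  if i ≤ 0 then 0
  else if h : (i - 1).toNat < N.toNat then p ⟨(i - 1).toNat, h⟩
  else M

/-- The partition pair `(q, p)` in `(N₁, M₁) × (N₂, M₂)` is restricted. -/
noncomputable def IsRestricted (N₁ M₁ N₂ M₂ a b α β : ℤ)
    (q : Fin N₁.toNat → ℤ) (p : Fin N₂.toNat → ℤ) : Prop :=
  (∀ i ∈ Finset.Icc (max 1 a) (min N₂ (N₁ + a - 1)),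
      1 - α ≤ boxPart N₂ M₂ p i - boxPart N₁ M₁ q (i + 1 - a)) ∧
  (∀ i ∈ Finset.Icc (max 1 b) (min N₁ (N₂ + b - 1)),
      1 - β ≤ boxPart N₁ M₁ q i - boxPart N₂ M₂ p (i + 1 - b)) ∧
  (a = 0 → boxPart N₁ M₁ q 1 ≤ α - 1) ∧
  (b = 0 → boxPart N₂ M₂ p 1 ≤ β - 1) ∧
  (a = N₂ - N₁ → M₁ - α + 1 ≤ boxPart N₂ M₂ p N₂) ∧
  (b = N₁ - N₂ → M₂ - β + 1 ≤ boxPart N₁ M₁ q N₁)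

noncomputable instance (N₁ M₁ N₂ M₂ a b α β : ℤ) (q : Fin N₁.toNat → ℤ) (p : Fin N₂.toNat → ℤ) :
    Decidable (IsRestricted N₁ M₁ N₂ M₂ a b α β q p) := by
  unfold IsRestricted
  infer_instance

/-- The set of restricted partition pairs `(q, p)` in `(N₁, M₁) × (N₂, M₂)`. -/
noncomputable def restrictedPairs (N₁ M₁ N₂ M₂ a b α β : ℤ) :
    Finset ((Fin N₁.toNat → ℤ) × (Fin N₂.toNat → ℤ)) :=
  (boxPartitions N₁ M₁ ×ˢ boxPartitions N₂ M₂).filter fun x =>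
    IsRestricted N₁ M₁ N₂ M₂ a b α β x.1 x.2

/-- The generating function `R(N₁, M₁, N₂, M₂, a, b, α, β)` of the restricted partition pairs by
weight, where the indeterminate `q` is `RatFunc.X`. -/
noncomputable def burgeR (N₁ M₁ N₂ M₂ a b α β : ℤ) : RatFunc ℚ :=
  ∑ x ∈ restrictedPairs N₁ M₁ N₂ M₂ a b α β,
    (RatFunc.X : RatFunc ℚ) ^ ((∑ j, x.1 j) + ∑ j, x.2 j)

/-- The `q`-shifted factorial `(q)_n = (1 - q)(1 - q²)⋯(1 - qⁿ)`. -/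
noncomputable def qFactorial (n : ℕ) : RatFunc ℚ :=
  ∏ j ∈ Finset.Icc 1 n, (1 - (RatFunc.X : RatFunc ℚ) ^ j)

/-- The Gaussian polynomial, equal to `(q)_P / ((q)_N (q)_{P-N})` if `P ≥ N ≥ 0` and to `0`
otherwise. -/
noncomputable def gaussianPoly (P N : ℤ) : RatFunc ℚ :=
  if 0 ≤ N ∧ N ≤ P then
    qFactorial P.toNat / (qFactorial N.toNat * qFactorial (P - N).toNat)
  else 0

/-!
Draw a partition as the lattice path from `(0, 0)` to `(N, M)` whose horizontal steps have the
parts as heights. The restrictions on a pair say that each path stays on one side of a translate of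
the other, so removing the last step of the path of `r` gives `R(N₁, M₁) = q^{M₁} R(N₁ - 1, M₁) +
R(N₁, M₁ - 1)`, and likewise for `p`. The sum over `i` satisfies the same recurrence: remove the
last step of `r` in its `i`-th term, the last step of `p` in the `i`-th term for `N₁ - 1`, and
apply the `q`-Pascal rule; what is left telescopes in `i`. Exchanging the two partitions shifts `i`
by `ΔN`, which gives the recurrence for `p`. The induction on `N₁ + M₁ + N₂ + M₂` stops where the
end points of the paths collide, and both sides vanish, or where the boxes are so flat that both
sides are the same Gaussian polynomial.
-/

theorem finsum_sub_comp_sub_right {G A : Type*} [AddGroup G] [AddCommGroup A] {f : G → A}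
    (hf : f.HasFiniteSupport) (g : G) : ∑ᶠ x, (f x - f (x - g)) = 0 := by
  have hshift : (fun x => f (x - g)).HasFiniteSupport :=
    hf.fun_comp_of_injective sub_left_injective
  have hsum : ∑ᶠ x, f (x - g) = ∑ᶠ x, f x := finsum_comp_equiv (Equiv.subRight g)
  rw [finsum_sub_distrib hf hshift, hsum, sub_self]

/-! ### Gaussian polynomials -/

theorem one_sub_ratFuncX_pow_ne_zero {K : Type*} [Field K] {n : ℕ} (hn : n ≠ 0) :
    1 - (RatFunc.X : RatFunc K) ^ n ≠ 0 := by
  have hpoly : (Polynomial.X ^ n - 1 : Polynomial K) ≠ 0 := by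
    simpa only [map_one] using Polynomial.X_pow_sub_C_ne_zero (Nat.pos_of_ne_zero hn) (1 : K)
  rw [← neg_sub, neg_ne_zero]
  simpa only [map_sub, map_pow, map_one, RatFunc.algebraMap_X] using
    RatFunc.algebraMap_ne_zero hpoly

theorem qFactorial_ne_zero (n : ℕ) : qFactorial n ≠ 0 :=
  Finset.prod_ne_zero_iff.2 fun _ hj =>
    one_sub_ratFuncX_pow_ne_zero (Nat.one_le_iff_ne_zero.1 (Finset.mem_Icc.1 hj).1)

theorem qFactorial_zero : qFactorial 0 = 1 := by
  rw [qFactorial, Finset.Icc_eq_empty (by omega), Finset.prod_empty]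

theorem qFactorial_succ (n : ℕ) :
    qFactorial (n + 1) = qFactorial n * (1 - RatFunc.X ^ (n + 1)) :=
  Finset.prod_Icc_succ_top (by omega) _

theorem gaussianPoly_eq_zero {P N : ℤ} (h : N < 0 ∨ P < N) : gaussianPoly P N = 0 :=
  if_neg (by omega)

theorem gaussianPoly_natCast_add (n m : ℕ) :
    gaussianPoly (n + m) n = qFactorial (n + m) / (qFactorial n * qFactorial m) := by
  rw [gaussianPoly, if_pos (by omega), add_sub_cancel_left, Int.toNat_natCast, Int.toNat_natCast,
    ← Nat.cast_add, Int.toNat_natCast]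

theorem gaussianPoly_zero_right {P : ℤ} (hP : 0 ≤ P) : gaussianPoly P 0 = 1 := by
  rw [gaussianPoly, if_pos ⟨le_rfl, hP⟩, sub_zero, Int.toNat_zero, qFactorial_zero, one_mul,
    div_self (qFactorial_ne_zero _)]

theorem gaussianPoly_self {P : ℤ} (hP : 0 ≤ P) : gaussianPoly P P = 1 := by
  rw [gaussianPoly, if_pos ⟨hP, le_rfl⟩, sub_self, Int.toNat_zero, qFactorial_zero, mul_one,
    div_self (qFactorial_ne_zero _)]

theorem gaussianPoly_pascal {P N : ℤ} (h : P ≠ 0 ∨ N ≠ 0) :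
    gaussianPoly P N =
      RatFunc.X ^ (P - N) * gaussianPoly (P - 1) (N - 1) + gaussianPoly (P - 1) N := by
  by_cases hout : N < 0 ∨ P < N
  · rw [gaussianPoly_eq_zero hout, gaussianPoly_eq_zero (N := N - 1) (by omega),
      gaussianPoly_eq_zero (by omega), mul_zero, add_zero]
  rcases (by omega : N = 0 ∨ 0 < N) with rfl | hN
  · rw [gaussianPoly_zero_right (by omega), gaussianPoly_eq_zero (by omega),
      gaussianPoly_zero_right (by omega), mul_zero, zero_add]
  rcases (by omega : N = P ∨ N < P) with rfl | hNP
  · rw [gaussianPoly_self (by omega), gaussianPoly_self (by omega),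
      gaussianPoly_eq_zero (by omega), sub_self, zpow_zero, one_mul, add_zero]
  obtain ⟨n, rfl⟩ : ∃ n : ℕ, N = (n + 1 : ℕ) := ⟨(N - 1).toNat, by omega⟩
  obtain ⟨m, rfl⟩ : ∃ m : ℕ, P = (n + 1 : ℕ) + (m + 1 : ℕ) :=
    ⟨(P - (n + 1 : ℕ) - 1).toNat, by omega⟩
  have hleft : ((n + 1 : ℕ) + (m + 1 : ℕ) - 1 : ℤ) = n + (m + 1 : ℕ) := by omega
  have hright : (n + (m + 1 : ℕ) : ℤ) = (n + 1 : ℕ) + m := by omega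
  rw [gaussianPoly_natCast_add, hleft, show ((n + 1 : ℕ) - 1 : ℤ) = n by omega,
    gaussianPoly_natCast_add, hright, gaussianPoly_natCast_add, add_sub_cancel_left, zpow_natCast,
    show n + 1 + (m + 1) = n + m + 1 + 1 by omega, show n + (m + 1) = n + m + 1 by omega,
    show n + 1 + m = n + m + 1 by omega, qFactorial_succ (n + m + 1), qFactorial_succ n,
    qFactorial_succ m]
  have := qFactorial_ne_zero n
  have := qFactorial_ne_zero m
  have := one_sub_ratFuncX_pow_ne_zero (K := ℚ) n.succ_ne_zero
  have := one_sub_ratFuncX_pow_ne_zero (K := ℚ) m.succ_ne_zero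
  field_simp
  ring

/-! ### Partitions in a box -/

theorem mem_boxPartitions {N M : ℤ} {p : Fin N.toNat → ℤ} :
    p ∈ boxPartitions N M ↔ (0 ≤ N ∧ 0 ≤ M) ∧ (∀ j, 0 ≤ p j ∧ p j ≤ M) ∧ Monotone p := by
  unfold boxPartitions
  split_ifs with h
  · simp only [Finset.mem_filter, Fintype.mem_piFinset, Finset.mem_Icc, Monotone, h, true_and,
      and_true]
  · simp only [Finset.notMem_empty, h, false_and]

theorem boxPartitions_eq_empty {N M : ℤ} (h : N < 0 ∨ M < 0) : boxPartitions N M = ∅ :=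
  if_neg (by omega)

theorem boxPartitions_zero {M : ℤ} (hM : 0 ≤ M) : boxPartitions 0 M = {fun _ => 0} := by
  refine Finset.eq_singleton_iff_unique_mem.2 ⟨mem_boxPartitions.2 ⟨⟨le_rfl, hM⟩, ?_⟩, ?_⟩
  · exact ⟨fun _ => ⟨le_rfl, hM⟩, monotone_const⟩
  · exact fun _ _ => funext fun j => Fin.elim0 j

theorem monotone_finSnoc_iff {A : Type*} [Preorder A] {n : ℕ} {r : Fin n → A} {x : A} :
    Monotone (Fin.snoc r x : Fin (n + 1) → A) ↔ Monotone r ∧ ∀ j, r j ≤ x := by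
  constructor
  · intro h
    refine ⟨fun j k hjk => ?_, fun j => ?_⟩
    · simpa only [Fin.snoc_castSucc] using h (Fin.castSucc_le_castSucc_iff.2 hjk)
    · simpa only [Fin.snoc_castSucc, Fin.snoc_last] using h (Fin.le_last j.castSucc)
  · rintro ⟨hr, hx⟩ j k hjk
    induction k using Fin.lastCases with
    | last =>
      induction j using Fin.lastCases with
      | last => exact le_rfl
      | cast j => simpa only [Fin.snoc_castSucc, Fin.snoc_last] using hx j
    | cast k =>
      obtain ⟨j, rfl⟩ := Fin.exists_castSucc_eq.2 (hjk.trans_lt (Fin.castSucc_lt_last k)).ne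
      simpa only [Fin.snoc_castSucc] using hr (Fin.castSucc_le_castSucc_iff.1 hjk)

/-- The partition `r` with the largest part `M` added. It is `Fin.snoc` with its types written as
in `boxPartitions`, where the length is an integer. -/
def appendPart {n : ℕ} (M : ℤ) (r : Fin (n : ℤ).toNat → ℤ) : Fin ((n + 1 : ℕ) : ℤ).toNat → ℤ :=
  Fin.snoc (n := n) (α := fun _ => ℤ) r M

theorem appendPart_mem_boxPartitions {n : ℕ} {M : ℤ} {r : Fin (n : ℤ).toNat → ℤ} :
    appendPart M r ∈ boxPartitions (n + 1 : ℕ) M ↔ r ∈ boxPartitions n M := by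
  have hparts : (∀ j, 0 ≤ appendPart M r j ∧ appendPart M r j ≤ M) ↔
      (∀ j, 0 ≤ r j ∧ r j ≤ M) ∧ 0 ≤ M := by
    refine (Fin.forall_fin_succ' (n := n)).trans (and_congr (forall_congr' fun j => ?_) ?_)
    · rw [appendPart, Fin.snoc_castSucc (n := n)]
    · rw [appendPart, Fin.snoc_last (n := n), and_iff_left le_rfl]
  have hmono : Monotone (appendPart M r) ↔ Monotone r ∧ ∀ j, r j ≤ M :=
    monotone_finSnoc_iff (n := n)
  rw [mem_boxPartitions, mem_boxPartitions, hparts, hmono]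
  constructor
  · rintro ⟨⟨-, hM⟩, ⟨hr, -⟩, hr', -⟩
    exact ⟨⟨by omega, hM⟩, hr, hr'⟩
  · rintro ⟨⟨-, hM⟩, hr, hr'⟩
    exact ⟨⟨by omega, hM⟩, ⟨hr, hM⟩, hr', fun j => (hr j).2⟩

theorem sum_appendPart {n : ℕ} (M : ℤ) (r : Fin (n : ℤ).toNat → ℤ) :
    ∑ j, appendPart M r j = ∑ j, r j + M :=
  Fin.sum_snoc (n := n) M r

theorem appendPart_last {n : ℕ} (M : ℤ) (r : Fin (n : ℤ).toNat → ℤ) :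
    appendPart M r (Fin.last n) = M :=
  Fin.snoc_last (n := n) (α := fun _ => ℤ) _ _

theorem appendPart_injective {n : ℕ} (M : ℤ) : Function.Injective (appendPart (n := n) M) :=
  Fin.snoc_left_injective (n := n) (α := fun _ => ℤ) M

theorem exists_appendPart_eq {n : ℕ} {M : ℤ} {r : Fin ((n + 1 : ℕ) : ℤ).toNat → ℤ}
    (h : r (Fin.last n) = M) : ∃ r', appendPart M r' = r := by
  subst h
  exact ⟨Fin.init (n := n) r, Fin.snoc_init_self (n := n) r⟩

theorem mem_boxPartitions_sub_one {n : ℕ} {M : ℤ} {r : Fin ((n + 1 : ℕ) : ℤ).toNat → ℤ} :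
    r ∈ boxPartitions (n + 1 : ℕ) (M - 1) ↔
      r ∈ boxPartitions (n + 1 : ℕ) M ∧ r (Fin.last n) ≠ M := by
  rw [mem_boxPartitions, mem_boxPartitions]
  constructor
  · rintro ⟨hNM, hr, hmono⟩
    have hlast := hr (Fin.last n)
    exact ⟨⟨by omega, fun j => ⟨(hr j).1, by linarith [(hr j).2]⟩, hmono⟩, by omega⟩
  · rintro ⟨⟨hNM, hr, hmono⟩, hlast⟩
    have hlast' := hr (Fin.last n)
    refine ⟨by omega, fun j => ⟨(hr j).1, ?_⟩, hmono⟩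
    have hj := hmono (Fin.le_last (n := n) j)
    omega

theorem sum_boxPartitions_succ {A : Type*} [AddCommMonoid A] (n : ℕ) (M : ℤ)
    (f : (Fin ((n + 1 : ℕ) : ℤ).toNat → ℤ) → A) :
    ∑ r ∈ boxPartitions (n + 1 : ℕ) M, f r =
      ∑ r ∈ boxPartitions n M, f (appendPart M r) +
        ∑ r ∈ boxPartitions (n + 1 : ℕ) (M - 1), f r := by
  have hfull : (boxPartitions (n + 1 : ℕ) M).filter (fun r => r (Fin.last n) = M) =
      (boxPartitions n M).map ⟨appendPart M, appendPart_injective M⟩ := by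
    ext r
    simp only [Finset.mem_filter, Finset.mem_map, Function.Embedding.coeFn_mk]
    constructor
    · rintro ⟨hr, hlast⟩
      obtain ⟨r', rfl⟩ := exists_appendPart_eq hlast
      exact ⟨r', appendPart_mem_boxPartitions.1 hr, rfl⟩
    · rintro ⟨r', hr', rfl⟩
      exact ⟨appendPart_mem_boxPartitions.2 hr', appendPart_last M r'⟩
  have hshort : (boxPartitions (n + 1 : ℕ) M).filter (fun r => r (Fin.last n) ≠ M) =
      boxPartitions (n + 1 : ℕ) (M - 1) := by
    ext r
    rw [Finset.mem_filter, mem_boxPartitions_sub_one]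
  rw [← Finset.sum_filter_add_sum_filter_not _ (fun r => r (Fin.last n) = M), hfull, hshort,
    Finset.sum_map]
  rfl

/-- The generating function of the partitions in `(N, M)` by weight. -/
noncomputable def boxGenFun (N M : ℤ) : RatFunc ℚ :=
  ∑ p ∈ boxPartitions N M, RatFunc.X ^ ∑ j, p j

theorem boxGenFun_eq_zero {N M : ℤ} (h : N < 0 ∨ M < 0) : boxGenFun N M = 0 := by
  rw [boxGenFun, boxPartitions_eq_empty h, Finset.sum_empty]

theorem boxGenFun_zero_left {M : ℤ} (hM : 0 ≤ M) : boxGenFun 0 M = 1 := by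
  rw [boxGenFun, boxPartitions_zero hM, Finset.sum_singleton, Finset.sum_const_zero, zpow_zero]

theorem boxGenFun_succ (n : ℕ) (M : ℤ) :
    boxGenFun (n + 1 : ℕ) M = RatFunc.X ^ M * boxGenFun n M + boxGenFun (n + 1 : ℕ) (M - 1) := by
  rw [boxGenFun, sum_boxPartitions_succ, boxGenFun, Finset.mul_sum, boxGenFun]
  simp only [sum_appendPart, add_comm _ M, zpow_add₀ (RatFunc.X_ne_zero (K := ℚ))]

theorem boxGenFun_eq_gaussianPoly (N M : ℤ) : boxGenFun N M = gaussianPoly (N + M) N := by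
  by_cases hneg : N < 0 ∨ M < -1
  · rw [boxGenFun_eq_zero (by omega), gaussianPoly_eq_zero (by omega)]
  have hM : -1 ≤ M := by omega
  lift N to ℕ using by omega
  clear hneg
  induction N generalizing M with
  | zero =>
    rw [Nat.cast_zero]
    rcases hM.eq_or_lt with rfl | hM
    · rw [boxGenFun_eq_zero (by omega), gaussianPoly_eq_zero (by omega)]
    · rw [boxGenFun_zero_left (by omega), gaussianPoly_zero_right (by omega)]
  | succ n ihn =>
    induction M, hM using Int.leInduction with
    | base => rw [boxGenFun_eq_zero (by omega), gaussianPoly_eq_zero (by omega)]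
    | succ M hM ihM =>
      have hP : ((n + 1 : ℕ) + (M + 1) - 1 : ℤ) = (n + 1 : ℕ) + M := by omega
      have hP' : ((n + 1 : ℕ) + M : ℤ) = n + (M + 1) := by omega
      rw [boxGenFun_succ, gaussianPoly_pascal (by omega), add_sub_cancel_right, ihM,
        ihn _ (by omega), add_sub_cancel_left, hP, ← hP', show ((n + 1 : ℕ) - 1 : ℤ) = n by omega]

theorem boxPart_of_nonpos {N i : ℤ} (hi : i ≤ 0) (M : ℤ) (p : Fin N.toNat → ℤ) :
    boxPart N M p i = 0 :=
  if_pos hi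

theorem boxPart_of_lt {N i : ℤ} (hi₀ : 0 < i) (hi : N < i) (M : ℤ) (p : Fin N.toNat → ℤ) :
    boxPart N M p i = M := by
  rw [boxPart, if_neg (by omega), dif_neg (by omega)]

theorem boxPart_mem_Icc {N M : ℤ} {p : Fin N.toNat → ℤ} (hp : p ∈ boxPartitions N M) (i : ℤ) :
    boxPart N M p i ∈ Set.Icc 0 M := by
  obtain ⟨⟨-, hM⟩, hparts, -⟩ := mem_boxPartitions.1 hp
  unfold boxPart
  split_ifs
  · exact ⟨le_rfl, hM⟩
  · exact hparts _
  · exact ⟨hM, le_rfl⟩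

theorem boxPart_congr_height {N i : ℤ} (hi : i ≤ N) (M M' : ℤ) (p : Fin N.toNat → ℤ) :
    boxPart N M p i = boxPart N M' p i := by
  unfold boxPart
  split_ifs
  · rfl
  · rfl
  · omega

theorem boxPart_appendPart {n : ℕ} (M : ℤ) (r : Fin (n : ℤ).toNat → ℤ) (i : ℤ) :
    boxPart (n + 1 : ℕ) M (appendPart M r) i = boxPart n M r i := by
  rcases le_or_gt i 0 with hi₀ | hi₀
  · rw [boxPart_of_nonpos hi₀, boxPart_of_nonpos hi₀]
  rcases le_or_gt i n with hi | hi
  · rw [boxPart, boxPart, if_neg (by omega), dif_pos (by omega), if_neg (by omega),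
      dif_pos (by omega)]
    exact Fin.snoc_castSucc (n := n) (α := fun _ => ℤ) _ _ ⟨(i - 1).toNat, by omega⟩
  rw [boxPart_of_lt hi₀ hi]
  rcases (by omega : i = n + 1 ∨ ((n + 1 : ℕ) : ℤ) < i) with rfl | hlt
  · rw [boxPart, if_neg (by omega), dif_pos (by omega)]
    simp only [add_sub_cancel_right, Int.toNat_natCast]
    exact appendPart_last M r
  · rw [boxPart_of_lt hi₀ hlt]

/-! ### Restricted pairs -/

section

variable {N₁ M₁ N₂ M₂ a b α β : ℤ}

theorem isRestricted_comm {r : Fin N₁.toNat → ℤ} {p : Fin N₂.toNat → ℤ} :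
    IsRestricted N₁ M₁ N₂ M₂ a b α β r p ↔ IsRestricted N₂ M₂ N₁ M₁ b a β α p r :=
  ⟨fun ⟨h₁, h₂, h₃, h₄, h₅, h₆⟩ => ⟨h₂, h₁, h₄, h₃, h₆, h₅⟩,
    fun ⟨h₁, h₂, h₃, h₄, h₅, h₆⟩ => ⟨h₂, h₁, h₄, h₃, h₆, h₅⟩⟩

/-- The lattice path of `p` stays above the lattice path of `r` shifted by `(a, -α)`. This is the
common form of the conditions on `(a, α)` in `IsRestricted`: by the conventions `p_0 = 0` and
`r_{N₁+1} = M₁`, those at the ends are the cases `i = 0` and `i = N₂`. -/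
def StaysAbove (N₁ M₁ N₂ M₂ a α : ℤ) (r : Fin N₁.toNat → ℤ) (p : Fin N₂.toNat → ℤ) : Prop :=
  ∀ i ∈ Finset.Icc a N₂, 1 - α ≤ boxPart N₂ M₂ p i - boxPart N₁ M₁ r (i + 1 - a)

theorem staysAbove_iff (hN₁ : 0 ≤ N₁) (hN₂ : 0 ≤ N₂) (ha₀ : 0 ≤ a) (ha : -a ≤ N₁ - N₂)
    {r : Fin N₁.toNat → ℤ} {p : Fin N₂.toNat → ℤ} :
    StaysAbove N₁ M₁ N₂ M₂ a α r p ↔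
      (∀ i ∈ Finset.Icc (max 1 a) (min N₂ (N₁ + a - 1)),
        1 - α ≤ boxPart N₂ M₂ p i - boxPart N₁ M₁ r (i + 1 - a)) ∧
      (a = 0 → boxPart N₁ M₁ r 1 ≤ α - 1) ∧
      (a = N₂ - N₁ → M₁ - α + 1 ≤ boxPart N₂ M₂ p N₂) := by
  have hstart : boxPart N₂ M₂ p 0 = 0 := boxPart_of_nonpos le_rfl _ _
  have hend : boxPart N₁ M₁ r (N₁ + 1) = M₁ := boxPart_of_lt (by omega) (by omega) _ _
  simp only [StaysAbove, Finset.mem_Icc]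
  constructor
  · refine fun h => ⟨fun i hi => h i (by omega), ?_, fun haN => ?_⟩
    · rintro rfl
      have h₀ := h 0 (by omega)
      rw [hstart, show (0 + 1 - 0 : ℤ) = 1 by omega] at h₀
      omega
    · have hN := h N₂ (by omega)
      rw [show N₂ + 1 - a = N₁ + 1 by omega, hend] at hN
      omega
  · rintro ⟨hmid, h₀, hN⟩ i hi
    rcases (by omega : i = 0 ∨ i = N₁ + a ∨ 1 ≤ i ∧ i ≤ N₁ + a - 1) with rfl | rfl | hi'
    · obtain rfl : a = 0 := by omega
      rw [hstart, show (0 + 1 - 0 : ℤ) = 1 by omega]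
      have := h₀ rfl
      omega
    · obtain rfl : N₂ = N₁ + a := by omega
      rw [show N₁ + a + 1 - a = N₁ + 1 by omega, hend]
      have := hN (by omega)
      omega
    · exact hmid i (by omega)

theorem isRestricted_iff_staysAbove (hN₁ : 0 ≤ N₁) (hN₂ : 0 ≤ N₂) (ha₀ : 0 ≤ a) (hb₀ : 0 ≤ b)
    (ha : -a ≤ N₁ - N₂) (hb : N₁ - N₂ ≤ b) {r : Fin N₁.toNat → ℤ} {p : Fin N₂.toNat → ℤ} :
    IsRestricted N₁ M₁ N₂ M₂ a b α β r p ↔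
      StaysAbove N₁ M₁ N₂ M₂ a α r p ∧ StaysAbove N₂ M₂ N₁ M₁ b β p r := by
  rw [staysAbove_iff hN₁ hN₂ ha₀ ha, staysAbove_iff hN₂ hN₁ hb₀ (by omega), IsRestricted]
  tauto

theorem isRestricted_sub_one_iff (hN₁ : 0 ≤ N₁) (hN₂ : 0 ≤ N₂) (ha₀ : 0 ≤ a) (hb₀ : 0 ≤ b)
    (ha : -a < N₁ - N₂) (hb : N₁ - N₂ ≤ b) {r : Fin N₁.toNat → ℤ} {p : Fin N₂.toNat → ℤ} :
    IsRestricted N₁ (M₁ - 1) N₂ M₂ a b α β r p ↔ IsRestricted N₁ M₁ N₂ M₂ a b α β r p := by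
  have hheight {i : ℤ} (hi : i ≤ N₁) := boxPart_congr_height hi (M₁ - 1) M₁ r
  rw [isRestricted_iff_staysAbove hN₁ hN₂ ha₀ hb₀ ha.le hb,
    isRestricted_iff_staysAbove hN₁ hN₂ ha₀ hb₀ ha.le hb]
  refine and_congr (forall₂_congr fun i hi => ?_) (forall₂_congr fun i hi => ?_)
  all_goals rw [Finset.mem_Icc] at hi
  · rw [hheight (by omega)]
  · rw [hheight hi.2]

theorem isRestricted_appendPart_iff {n : ℕ} (hN₂ : 0 ≤ N₂) (ha₀ : 0 ≤ a) (hb₀ : 0 ≤ b)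
    (ha : -a < (n + 1 : ℕ) - N₂) (hb : (n + 1 : ℕ) - N₂ ≤ b) (hβ : -β < M₁ - M₂)
    {r : Fin (n : ℤ).toNat → ℤ} {p : Fin N₂.toNat → ℤ} (hp : p ∈ boxPartitions N₂ M₂) :
    IsRestricted (n + 1 : ℕ) M₁ N₂ M₂ a b α β (appendPart M₁ r) p ↔
      IsRestricted n M₁ N₂ M₂ a b α β r p := by
  rw [isRestricted_iff_staysAbove (by omega) hN₂ ha₀ hb₀ ha.le hb,
    isRestricted_iff_staysAbove (by omega) hN₂ ha₀ hb₀ (by omega) (by omega)]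
  simp only [StaysAbove, boxPart_appendPart, Finset.mem_Icc]
  refine and_congr_right fun _ => ⟨fun h i hi => h i (by omega), fun h i hi => ?_⟩
  rcases (by omega : i ≤ n ∨ i = n + 1) with hi' | rfl
  · exact h i (by omega)
  · have hle := (boxPart_mem_Icc hp (n + 1 + 1 - b)).2
    rw [boxPart_of_lt (by omega) (by omega)]
    omega

theorem burgeR_eq_sum_sum (N₁ M₁ N₂ M₂ a b α β : ℤ) :
    burgeR N₁ M₁ N₂ M₂ a b α β =
      ∑ r ∈ boxPartitions N₁ M₁, ∑ p ∈ boxPartitions N₂ M₂,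
        if IsRestricted N₁ M₁ N₂ M₂ a b α β r p then RatFunc.X ^ (∑ j, r j + ∑ j, p j) else 0 := by
  rw [burgeR, restrictedPairs, Finset.sum_filter, Finset.sum_product]

theorem burgeR_comm (N₁ M₁ N₂ M₂ a b α β : ℤ) :
    burgeR N₁ M₁ N₂ M₂ a b α β = burgeR N₂ M₂ N₁ M₁ b a β α := by
  rw [burgeR_eq_sum_sum, burgeR_eq_sum_sum, Finset.sum_comm]
  refine Finset.sum_congr rfl fun p _ => Finset.sum_congr rfl fun r _ => ?_
  rw [add_comm]
  exact if_congr isRestricted_comm rfl rfl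

theorem burgeR_eq_zero_of_neg (h : N₁ < 0 ∨ M₁ < 0 ∨ N₂ < 0 ∨ M₂ < 0) (a b α β : ℤ) :
    burgeR N₁ M₁ N₂ M₂ a b α β = 0 := by
  rw [burgeR_eq_sum_sum]
  rcases (by omega : (N₁ < 0 ∨ M₁ < 0) ∨ (N₂ < 0 ∨ M₂ < 0)) with h | h
  · rw [boxPartitions_eq_empty h, Finset.sum_empty]
  · simp only [boxPartitions_eq_empty h, Finset.sum_empty, Finset.sum_const_zero]

/-- If the shifted path of `r` ends where the path of `p` does, it cannot stay below it. -/
theorem burgeR_eq_zero_of_collision (hN : N₁ - N₂ = -a) (hM : M₁ - M₂ = α) (b β : ℤ) :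
    burgeR N₁ M₁ N₂ M₂ a b α β = 0 := by
  refine Finset.sum_eq_zero fun x hx => ?_
  obtain ⟨hbox, -, -, -, -, hend, -⟩ := Finset.mem_filter.1 hx
  have hle := (boxPart_mem_Icc (Finset.mem_product.1 hbox).2 N₂).2
  have := hend (by omega)
  omega

theorem burgeR_eq_boxGenFun_mul (h : M₁ < α ∨ N₂ < a) (h' : M₂ < β ∨ N₁ < b) :
    burgeR N₁ M₁ N₂ M₂ a b α β = boxGenFun N₁ M₁ * boxGenFun N₂ M₂ := by
  rw [burgeR_eq_sum_sum, boxGenFun, boxGenFun, Finset.sum_mul_sum]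
  refine Finset.sum_congr rfl fun r hr => Finset.sum_congr rfl fun p hp => ?_
  have hr' (i : ℤ) : 0 ≤ boxPart N₁ M₁ r i ∧ boxPart N₁ M₁ r i ≤ M₁ := boxPart_mem_Icc hr i
  have hp' (i : ℤ) : 0 ≤ boxPart N₂ M₂ p i ∧ boxPart N₂ M₂ p i ≤ M₂ := boxPart_mem_Icc hp i
  rw [if_pos, zpow_add₀ RatFunc.X_ne_zero]
  obtain ⟨⟨hN₁, -⟩, -⟩ := mem_boxPartitions.1 hr
  obtain ⟨⟨hN₂, -⟩, -⟩ := mem_boxPartitions.1 hp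
  refine ⟨fun i hi => ?_, fun i hi => ?_, fun _ => ?_, fun _ => ?_, fun _ => ?_, fun _ => ?_⟩
  · rw [Finset.mem_Icc] at hi
    linarith [(hp' i).1, (hr' (i + 1 - a)).2, h.resolve_right (by omega)]
  · rw [Finset.mem_Icc] at hi
    linarith [(hr' i).1, (hp' (i + 1 - b)).2, h'.resolve_right (by omega)]
  · linarith [(hr' 1).2, h.resolve_right (by omega)]
  · linarith [(hp' 1).2, h'.resolve_right (by omega)]
  · linarith [(hp' N₂).1, h.resolve_right (by omega)]
  · linarith [(hr' N₁).1, h'.resolve_right (by omega)]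

/-- Remove the last step of the path of `r`: it is either a horizontal one, at height `M₁`, or a
vertical one. -/
theorem burgeR_recurrence_fst (hNM : N₁ + M₁ ≠ 0) (ha₀ : 0 ≤ a) (hb₀ : 0 ≤ b)
    (ha : -a < N₁ - N₂) (hb : N₁ - N₂ ≤ b) (hβ : -β < M₁ - M₂) :
    burgeR N₁ M₁ N₂ M₂ a b α β =
      RatFunc.X ^ M₁ * burgeR (N₁ - 1) M₁ N₂ M₂ a b α β + burgeR N₁ (M₁ - 1) N₂ M₂ a b α β := by
  by_cases hneg : N₁ < 0 ∨ M₁ < 0 ∨ N₂ < 0 ∨ M₂ < 0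
  · rw [burgeR_eq_zero_of_neg hneg, burgeR_eq_zero_of_neg (by omega),
      burgeR_eq_zero_of_neg (by omega), mul_zero, add_zero]
  have hN₁ : 0 ≤ N₁ := by omega
  have hN₂ : 0 ≤ N₂ := by omega
  have hshort : burgeR N₁ (M₁ - 1) N₂ M₂ a b α β =
      ∑ r ∈ boxPartitions N₁ (M₁ - 1), ∑ p ∈ boxPartitions N₂ M₂,
        if IsRestricted N₁ M₁ N₂ M₂ a b α β r p then RatFunc.X ^ (∑ j, r j + ∑ j, p j) else 0 := by
    simp only [burgeR_eq_sum_sum, isRestricted_sub_one_iff hN₁ hN₂ ha₀ hb₀ ha hb]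
  rw [hshort, burgeR_eq_sum_sum]
  rcases hN₁.eq_or_lt with rfl | hpos
  · rw [burgeR_eq_zero_of_neg (by omega), mul_zero, zero_add, boxPartitions_zero (by omega),
      boxPartitions_zero (by omega)]
  obtain ⟨n, rfl⟩ : ∃ n : ℕ, N₁ = (n + 1 : ℕ) := ⟨(N₁ - 1).toNat, by omega⟩
  rw [sum_boxPartitions_succ, add_left_inj, show ((n + 1 : ℕ) - 1 : ℤ) = n by omega,
    burgeR_eq_sum_sum, Finset.mul_sum]
  refine Finset.sum_congr rfl fun r _ => ?_
  rw [Finset.mul_sum]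
  refine Finset.sum_congr rfl fun p hp => ?_
  rw [mul_ite, mul_zero, sum_appendPart, ← zpow_add₀ RatFunc.X_ne_zero, add_comm _ M₁, add_assoc]
  exact if_congr (isRestricted_appendPart_iff hN₂ ha₀ hb₀ ha hb hβ hp) rfl rfl

theorem burgeR_recurrence_snd (hNM : N₂ + M₂ ≠ 0) (ha₀ : 0 ≤ a) (hb₀ : 0 ≤ b)
    (ha : -a ≤ N₁ - N₂) (hb : N₁ - N₂ < b) (hα : M₁ - M₂ < α) :
    burgeR N₁ M₁ N₂ M₂ a b α β =
      RatFunc.X ^ M₂ * burgeR N₁ M₁ (N₂ - 1) M₂ a b α β + burgeR N₁ M₁ N₂ (M₂ - 1) a b α β := by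
  rw [burgeR_comm, burgeR_recurrence_fst hNM hb₀ ha₀ (by omega) (by omega) (by omega),
    burgeR_comm (N₂ - 1), burgeR_comm N₂]

end

/-! ### The Burge sum -/

section

variable {N₁ M₁ N₂ M₂ a b α β i : ℤ}

/-- The `i`-th summand of the Burge summation formula, with `N₁ - N₂` for `ΔN`. -/
noncomputable def burgeTerm (N₁ M₁ N₂ M₂ a b α β i : ℤ) : RatFunc ℚ :=
  RatFunc.X ^ (i ^ 2 + i * (N₁ - N₂)) * gaussianPoly (M₁ + M₂ + N₂ - i) (N₂ - i) *
    burgeR (i + (N₁ - N₂)) (M₁ - i) i (M₂ - (N₁ - N₂) - i) a b (α - a) (β - b)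

/-- The right-hand side of the Burge summation formula, as a sum over all integers: this makes its
symmetry a shift of the summation index. -/
noncomputable def burgeSum (N₁ M₁ N₂ M₂ a b α β : ℤ) : RatFunc ℚ :=
  ∑ᶠ i, burgeTerm N₁ M₁ N₂ M₂ a b α β i

/-- The certificate of the recurrence of `burgeSum`: the defect of the recurrence for
`burgeTerm` at `i` is its difference between `i` and `i - 1`. -/
noncomputable def burgeCertificate (N₁ M₁ N₂ M₂ a b α β i : ℤ) : RatFunc ℚ :=
  RatFunc.X ^ (i ^ 2 + i * (N₁ - N₂) + M₁ + M₂) *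
    gaussianPoly (M₁ + M₂ + N₂ - i - 1) (N₂ - i - 1) *
    burgeR (i + (N₁ - N₂)) (M₁ - 1 - i) i (M₂ - (N₁ - N₂) - i) a b (α - a) (β - b)

theorem burgeTerm_eq_zero (h : i < 0 ∨ i + (N₁ - N₂) < 0 ∨ N₂ < i ∨ M₁ < i ∨ M₂ < i + (N₁ - N₂))
    (a b α β : ℤ) : burgeTerm N₁ M₁ N₂ M₂ a b α β i = 0 := by
  rw [burgeTerm]
  rcases lt_or_ge N₂ i with hi | hi
  · rw [gaussianPoly_eq_zero (by omega), mul_zero, zero_mul]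
  · rw [burgeR_eq_zero_of_neg (by omega), mul_zero]

theorem support_burgeTerm_subset (N₁ M₁ N₂ M₂ a b α β : ℤ) :
    Function.support (burgeTerm N₁ M₁ N₂ M₂ a b α β) ⊆ Finset.Icc 0 N₂ := by
  intro i hi
  rw [Finset.coe_Icc, Set.mem_Icc]
  by_contra hout
  exact hi (burgeTerm_eq_zero (by omega) a b α β)

theorem hasFiniteSupport_burgeTerm (N₁ M₁ N₂ M₂ a b α β : ℤ) :
    (burgeTerm N₁ M₁ N₂ M₂ a b α β).HasFiniteSupport :=
  (Finset.finite_toSet _).subset (support_burgeTerm_subset N₁ M₁ N₂ M₂ a b α β)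

theorem hasFiniteSupport_burgeCertificate (N₁ M₁ N₂ M₂ a b α β : ℤ) :
    (burgeCertificate N₁ M₁ N₂ M₂ a b α β).HasFiniteSupport := by
  refine (Set.finite_Icc 0 N₂).subset fun i hi => ?_
  by_contra hout
  rw [Set.mem_Icc] at hout
  rcases (by omega : i < 0 ∨ N₂ < i) with hneg | hlt
  · exact hi (by rw [burgeCertificate, burgeR_eq_zero_of_neg (by omega), mul_zero])
  · exact hi (by rw [burgeCertificate, gaussianPoly_eq_zero (by omega), mul_zero, zero_mul])

theorem burgeSum_eq_sum (N₁ M₁ N₂ M₂ a b α β : ℤ) :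
    burgeSum N₁ M₁ N₂ M₂ a b α β = ∑ i ∈ Finset.Icc 0 N₂, burgeTerm N₁ M₁ N₂ M₂ a b α β i :=
  finsum_eq_sum_of_support_subset _ (support_burgeTerm_subset N₁ M₁ N₂ M₂ a b α β)

theorem burgeTerm_comm (N₁ M₁ N₂ M₂ a b α β i : ℤ) :
    burgeTerm N₁ M₁ N₂ M₂ a b α β i = burgeTerm N₂ M₂ N₁ M₁ b a β α (i + (N₁ - N₂)) := by
  rw [burgeTerm, burgeTerm, burgeR_comm]
  congr 1
  · congr 2 <;> ring
  · congr 1 <;> ring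

theorem burgeSum_comm (N₁ M₁ N₂ M₂ a b α β : ℤ) :
    burgeSum N₁ M₁ N₂ M₂ a b α β = burgeSum N₂ M₂ N₁ M₁ b a β α :=
  (finsum_congr (burgeTerm_comm N₁ M₁ N₂ M₂ a b α β)).trans
    (finsum_comp_equiv (Equiv.addRight (N₁ - N₂)))

theorem burgeSum_eq_zero_of_neg (h : N₁ < 0 ∨ M₁ < 0 ∨ N₂ < 0 ∨ M₂ < 0) (a b α β : ℤ) :
    burgeSum N₁ M₁ N₂ M₂ a b α β = 0 :=
  finsum_eq_zero_of_forall_eq_zero fun _ => burgeTerm_eq_zero (by omega) a b α β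

theorem burgeSum_eq_zero_of_collision (hN : N₁ - N₂ = -a) (hM : M₁ - M₂ = α) (b β : ℤ) :
    burgeSum N₁ M₁ N₂ M₂ a b α β = 0 :=
  finsum_eq_zero_of_forall_eq_zero fun _ => by
    rw [burgeTerm, burgeR_eq_zero_of_collision (by omega) (by omega), mul_zero]

theorem burgeTerm_recurrence_fst (ha₀ : 0 ≤ a) (hb₀ : 0 ≤ b)
    (ha : -a < N₁ - N₂) (hb : N₁ - N₂ ≤ b) (hβ : b - β < M₁ - M₂ + (N₁ - N₂))
    (hα : M₁ - M₂ + (N₁ - N₂) ≤ α - a) (hM₁ : 0 < M₁ + (N₁ - N₂)) (hM₂ : 0 ≤ M₂ - (N₁ - N₂))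
    (i : ℤ) :
    burgeTerm N₁ M₁ N₂ M₂ a b α β i =
      RatFunc.X ^ M₁ * burgeTerm (N₁ - 1) M₁ N₂ M₂ a b α β i +
        burgeTerm N₁ (M₁ - 1) N₂ M₂ a b α β i +
        (burgeCertificate N₁ M₁ N₂ M₂ a b α β i -
          burgeCertificate N₁ M₁ N₂ M₂ a b α β (i - 1)) := by
  have hX : (RatFunc.X : RatFunc ℚ) ≠ 0 := RatFunc.X_ne_zero
  set ΔN := N₁ - N₂ with hΔN
  -- Removing the last step of `r` on the left-hand side and of `p` in the term of `N₁ - 1` leaves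
  -- only the three series `U`, `Z i` and `Z (i - 1)`.
  let U := burgeR (i + ΔN - 1) (M₁ - i) i (M₂ - ΔN - i) a b (α - a) (β - b)
  let Z (j : ℤ) := burgeR (j + ΔN) (M₁ - 1 - j) j (M₂ - ΔN - j) a b (α - a) (β - b)
  have hfst : burgeR (i + ΔN) (M₁ - i) i (M₂ - ΔN - i) a b (α - a) (β - b) =
      RatFunc.X ^ (M₁ - i) * U + Z i := by
    rw [burgeR_recurrence_fst (by omega) ha₀ hb₀ (by omega) (by omega) (by omega),
      sub_right_comm M₁ i 1]
  have hsnd : burgeR (i + (N₁ - 1 - N₂)) (M₁ - i) i (M₂ - (N₁ - 1 - N₂) - i) a b (α - a) (β - b) =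
      RatFunc.X ^ (M₂ - ΔN + 1 - i) * Z (i - 1) + U := by
    rw [burgeR_recurrence_snd (by omega) ha₀ hb₀ (by omega) (by omega) (by omega)]
    simp only [U, Z, hΔN]
    ring_nf
  have hpascal := gaussianPoly_pascal (P := M₁ + M₂ + N₂ - i) (N := N₂ - i) (by omega)
  rw [show M₁ + M₂ + N₂ - i - (N₂ - i) = M₁ + M₂ by ring] at hpascal
  have hfstExp : (RatFunc.X : RatFunc ℚ) ^ (i ^ 2 + i * ΔN) * RatFunc.X ^ (M₁ - i) =
      RatFunc.X ^ M₁ * RatFunc.X ^ (i ^ 2 + i * (N₁ - 1 - N₂)) := by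
    rw [← zpow_add₀ hX, ← zpow_add₀ hX]
    congr 1
    ring
  have hcertExp : (RatFunc.X : RatFunc ℚ) ^ (i ^ 2 + i * ΔN + M₁ + M₂) =
      RatFunc.X ^ (i ^ 2 + i * ΔN) * RatFunc.X ^ (M₁ + M₂) := by
    rw [← zpow_add₀ hX, add_assoc]
  have hcertExp' : (RatFunc.X : RatFunc ℚ) ^ ((i - 1) ^ 2 + (i - 1) * ΔN + M₁ + M₂) =
      RatFunc.X ^ M₁ * RatFunc.X ^ (i ^ 2 + i * (N₁ - 1 - N₂)) * RatFunc.X ^ (M₂ - ΔN + 1 - i) := by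
    rw [← zpow_add₀ hX, ← zpow_add₀ hX]
    congr 1
    ring
  simp only [burgeTerm, burgeCertificate, ← hΔN]
  rw [hfst, hsnd, hcertExp, hcertExp', show M₁ - 1 + M₂ + N₂ - i = M₁ + M₂ + N₂ - i - 1 by ring,
    show M₁ + M₂ + N₂ - (i - 1) - 1 = M₁ + M₂ + N₂ - i by ring,
    show N₂ - (i - 1) - 1 = N₂ - i by ring]
  linear_combination gaussianPoly (M₁ + M₂ + N₂ - i) (N₂ - i) * U * hfstExp +
    RatFunc.X ^ (i ^ 2 + i * ΔN) * Z i * hpascal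

theorem burgeSum_recurrence_fst (ha₀ : 0 ≤ a) (hb₀ : 0 ≤ b)
    (ha : -a < N₁ - N₂) (hb : N₁ - N₂ ≤ b) (hβ : b - β < M₁ - M₂ + (N₁ - N₂))
    (hα : M₁ - M₂ + (N₁ - N₂) ≤ α - a) (hM₁ : 0 < M₁ + (N₁ - N₂)) (hM₂ : 0 ≤ M₂ - (N₁ - N₂)) :
    burgeSum N₁ M₁ N₂ M₂ a b α β =
      RatFunc.X ^ M₁ * burgeSum (N₁ - 1) M₁ N₂ M₂ a b α β +
        burgeSum N₁ (M₁ - 1) N₂ M₂ a b α β := by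
  have hcert := hasFiniteSupport_burgeCertificate N₁ M₁ N₂ M₂ a b α β
  have hdiff := hcert.fun_sub (hcert.fun_comp_of_injective (g := (· - 1)) sub_left_injective)
  have hterm := hasFiniteSupport_burgeTerm (N₁ - 1) M₁ N₂ M₂ a b α β
  have hterm' := hasFiniteSupport_burgeTerm N₁ (M₁ - 1) N₂ M₂ a b α β
  simp only [burgeSum, burgeTerm_recurrence_fst ha₀ hb₀ ha hb hβ hα hM₁ hM₂]
  rw [finsum_add_distrib, finsum_add_distrib, finsum_sub_comp_sub_right hcert, add_zero, mul_finsum]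
  all_goals fun_prop

theorem burgeSum_recurrence_snd (ha₀ : 0 ≤ a) (hb₀ : 0 ≤ b)
    (ha : -a ≤ N₁ - N₂) (hb : N₁ - N₂ < b) (hβ : b - β ≤ M₁ - M₂ + (N₁ - N₂))
    (hα : M₁ - M₂ + (N₁ - N₂) < α - a) (hM₁ : 0 ≤ M₁ + (N₁ - N₂)) (hM₂ : 0 < M₂ - (N₁ - N₂)) :
    burgeSum N₁ M₁ N₂ M₂ a b α β =
      RatFunc.X ^ M₂ * burgeSum N₁ M₁ (N₂ - 1) M₂ a b α β +
        burgeSum N₁ M₁ N₂ (M₂ - 1) a b α β := by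
  rw [burgeSum_comm, burgeSum_recurrence_fst hb₀ ha₀ (by omega) (by omega) (by omega) (by omega)
    (by omega) (by omega), burgeSum_comm (N₂ - 1), burgeSum_comm N₂]

/-! ### The summation formula -/

/-- When `M₂ = N₁ - N₂`, only the term `i = 0` of the Burge sum survives. -/
theorem burgeR_eq_burgeSum_of_flat (hN₁ : 0 ≤ N₁) (hM₁ : 0 ≤ M₁) (hM₂ : 0 ≤ M₂)
    (h : M₂ = N₁ - N₂) (hflat : M₁ = 0 ∨ M₂ = 0) (hα : M₁ < α) (hβ : M₂ < β)
    (hα' : M₁ < α - a ∨ 0 < a) (hβ' : 0 < β - b ∨ M₂ < b) :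
    burgeR N₁ M₁ N₂ M₂ a b α β = burgeSum N₁ M₁ N₂ M₂ a b α β := by
  rw [burgeSum, finsum_eq_single _ 0 fun i hi => burgeTerm_eq_zero (by omega) a b α β, burgeTerm,
    ← h, sub_self, sub_zero, sub_zero, sub_zero, sub_zero, zero_add,
    burgeR_eq_boxGenFun_mul (.inl hα) (.inl hβ), burgeR_eq_boxGenFun_mul hα' hβ']
  simp only [boxGenFun_eq_gaussianPoly, zero_pow two_ne_zero, zero_mul, add_zero, zpow_zero,
    one_mul, gaussianPoly_self le_rfl, mul_one]
  rcases hflat with rfl | rfl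
  · rw [add_zero, add_zero, gaussianPoly_self hN₁, gaussianPoly_self hM₂, one_mul, mul_one,
      zero_add, add_comm N₂]
  · obtain rfl : N₁ = N₂ := by omega
    rw [add_zero, add_zero, zero_add, gaussianPoly_self hN₁, gaussianPoly_zero_right hM₁,
      add_comm N₁]

theorem burgeR_eq_burgeSum (ha : 0 ≤ a) (hb : 0 ≤ b) (hab : 0 < a + b)
    (hα : 0 ≤ α - a) (hβ : 0 ≤ β - b) (hαβ : 0 < (α - a) + (β - b))
    (h₁ : -a ≤ N₁ - N₂) (h₂ : N₁ - N₂ ≤ b) (h₅ : b - β ≤ M₁ - M₂ + (N₁ - N₂))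
    (h₆ : M₁ - M₂ + (N₁ - N₂) ≤ α - a) (h₇ : 0 ≤ M₁ + (N₁ - N₂)) (h₈ : 0 ≤ M₂ - (N₁ - N₂)) :
    burgeR N₁ M₁ N₂ M₂ a b α β = burgeSum N₁ M₁ N₂ M₂ a b α β := by
  induction hsize : (N₁ + M₁ + N₂ + M₂).toNat using Nat.strong_induction_on
    generalizing N₁ M₁ N₂ M₂ with
  | _ k ih =>
  by_cases hneg : N₁ < 0 ∨ M₁ < 0 ∨ N₂ < 0 ∨ M₂ < 0
  · rw [burgeR_eq_zero_of_neg hneg, burgeSum_eq_zero_of_neg hneg]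
  push Not at hneg
  obtain ⟨hN₁, hM₁, hN₂, hM₂⟩ := hneg
  by_cases hcoll : N₁ - N₂ = -a ∧ M₁ - M₂ = α
  · rw [burgeR_eq_zero_of_collision hcoll.1 hcoll.2, burgeSum_eq_zero_of_collision hcoll.1 hcoll.2]
  by_cases hcoll' : N₂ - N₁ = -b ∧ M₂ - M₁ = β
  · rw [burgeR_comm, burgeSum_comm, burgeR_eq_zero_of_collision hcoll'.1 hcoll'.2,
      burgeSum_eq_zero_of_collision hcoll'.1 hcoll'.2]
  by_cases hfst : -a < N₁ - N₂ ∧ b - β < M₁ - M₂ + (N₁ - N₂) ∧ 0 < M₁ + (N₁ - N₂)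
  · rw [burgeR_recurrence_fst (by omega) ha hb hfst.1 h₂ (by omega),
      burgeSum_recurrence_fst ha hb hfst.1 h₂ hfst.2.1 h₆ hfst.2.2 h₈]
    congr 2 <;> refine ih _ ?_ ?_ ?_ ?_ ?_ ?_ ?_ rfl <;> omega
  by_cases hsnd : N₁ - N₂ < b ∧ M₁ - M₂ + (N₁ - N₂) < α - a ∧ 0 < M₂ - (N₁ - N₂)
  · rw [burgeR_recurrence_snd (by omega) ha hb h₁ hsnd.1 (by omega),
      burgeSum_recurrence_snd ha hb h₁ hsnd.1 h₅ hsnd.2.1 h₇ hsnd.2.2]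
    congr 2 <;> refine ih _ ?_ ?_ ?_ ?_ ?_ ?_ ?_ rfl <;> omega
  rcases (by omega : M₂ = N₁ - N₂ ∨ M₁ = N₂ - N₁) with hflat | hflat
  · apply burgeR_eq_burgeSum_of_flat <;> omega
  · rw [burgeR_comm, burgeSum_comm]
    apply burgeR_eq_burgeSum_of_flat <;> omega

end

theorem mainTheorem8 (N₁ M₁ N₂ M₂ a b α β ΔN ΔM : ℤ)
    (hN₁ : 0 ≤ N₁) (hM₁ : 0 ≤ M₁) (hN₂ : 0 ≤ N₂) (hM₂ : 0 ≤ M₂)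
    (ha : 0 ≤ a) (hb : 0 ≤ b) (hab : 0 < a + b)
    (hα : 0 ≤ α - a) (hβ : 0 ≤ β - b) (hαβ : 0 < (α - a) + (β - b))
    (hΔN : ΔN = N₁ - N₂) (hΔM : ΔM = M₁ - M₂)
    (h₁ : -a ≤ ΔN) (h₂ : ΔN ≤ b) (h₃ : -β ≤ ΔM) (h₄ : ΔM ≤ α)
    (h₅ : b - β ≤ ΔM + ΔN) (h₆ : ΔM + ΔN ≤ α - a)
    (h₇ : 0 ≤ M₁ + ΔN) (h₈ : 0 ≤ M₂ - ΔN) :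
    burgeR N₁ M₁ N₂ M₂ a b α β =
      ∑ i ∈ Finset.Icc 0 N₂,
        (RatFunc.X : RatFunc ℚ) ^ (i ^ 2 + i * ΔN) *
          gaussianPoly (M₁ + M₂ + N₂ - i) (N₂ - i) *
          burgeR (i + ΔN) (M₁ - i) i (M₂ - ΔN - i) a b (α - a) (β - b) := by
  subst hΔN hΔM
  rw [burgeR_eq_burgeSum ha hb hab hα hβ hαβ h₁ h₂ h₅ h₆ h₇ h₈, burgeSum_eq_sum]
  rfl
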